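/- There exist a probability space $(\Omega,\mathcal F,\mathbb P)$, an ergodic family $(\tau_x)_{x\in\mathbb R^2}$ of measure-preserving transformations of $\Omega$ with $\tau_0=\mathrm{id}$, $\tau_x\circ\tau_y=\tau_{x+y}$ and $(x,\omega)\mapsto\tau_x\omega$ measurable, and a measurable field $V_2:\mathbb R\times\Omega\to\mathbb R$ with the following properties. (Ergodic means: if $D\in\mathcal F$ and $\tau_z(D)=D$ for all $z$, then $\mathbb P[D]\in\{0,1\}$.) The horizontal translations $(\tau_{(r,0)})_{r\in\mathbb R}$ alone are also ergodic. Almost surely $V_2(r,\tau_{(s,0)}\omega)=V_2(r+s,\omega)$ for all $r,s\in\mathbb R$, and the vector field $V(x,\omega)=(0,V_2(x_1,\omega))$ on $\mathbb R^2$ is stationary, i.e. almost surely $V(y,\tau_z\omega)=V(y+z,\omega)$ for all $y,z\in\mathbb R^2$. Moreover: 1. $\mathbb E[V_2(r,\cdot)]=0$ for every $r\in\mathbb R$; 2. almost surely, $V_2(\cdot,\omega)$ is bounded, continuously differentiable and Lipschitz, with Lipschitz derivative (that is, $V_2(\cdot,\omega)\in C^{1,1}(\mathbb R)$), and $|V_2(r,\omega)|\le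 2$ for all $r$; 3. almost surely the minimum $\delta(\omega)=\min\{|r| : |V_2(r,\omega)|\le 1\}$ exists, and $\mathbb E[\delta]=\infty$; 4. for $x,y\in\mathbb R^2$ let $\theta(x,y,\omega)\in[0,\infty]$ be the minimal time to reach $y$ from $x$, i.e. the infimum of all $t\ge 0$ for which there are a measurable control $\alpha:\mathbb R\to\{a\in\mathbb R^2:|a|\le1\}$ and a locally absolutely continuous $X:\mathbb R\to\mathbb R^2$ with $X'(s)=\alpha(s)+V(X(s),\omega)$ for a.e. $s$, $X(0)=x$ and $X(t)=y$ (and $\theta=\infty$ if there is no such $t$). Then, with $e_2=(0,1)$, $$\mathbb E[\theta(0,e_2,\cdot)]=\infty\quad\text{or}\quad \mathbb E[\theta(0,-e_2,\cdot)]=\infty .$$ -/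

import Mathlib

open MeasureTheory Set
open scoped ENNReal

/-- `τ` is an ergodic group of measure-preserving transformations of `(Ω, P)` indexed by the
additive group `G` of translations (here `ℝ` or `ℝ^N`), jointly measurable. -/
structure IsErgodicEnvironment {G Ω : Type*} [AddGroup G] [MeasurableSpace G] [MeasurableSpace Ω]
    (P : Measure Ω) (τ : G → Ω → Ω) : Prop where
  measurable_uncurry : Measurable (fun p : G × Ω => τ p.1 p.2)
  measurePreserving : ∀ x, MeasurePreserving (τ x) P P
  zero : τ 0 = id
  add : ∀ x y, τ x ∘ τ y = τ (x + y)
  ergodic : ∀ D : Set Ω, MeasurableSet D → (∀ z, τ z '' D = D) → P D = 0 ∨ P D = 1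

/-- `f` is a measurable random field on `G`, stationary with respect to `τ`:
almost surely, `f (y, τ_z ω) = f (y + z, ω)` for all `y` and `z`. -/
structure IsStationaryField {G Ω β : Type*} [AddGroup G] [MeasurableSpace G] [MeasurableSpace Ω]
    [MeasurableSpace β] (P : Measure Ω) (τ : G → Ω → Ω) (f : G → Ω → β) : Prop where
  measurable_uncurry : Measurable (fun p : G × Ω => f p.1 p.2)
  stationary : ∀ᵐ ω ∂P, ∀ y z, f y (τ z ω) = f (y + z) ω

/-- `C^{1,1}(ℝ)`: bounded and continuously differentiable functions that are
Lipschitz continuous and have a Lipschitz continuous derivative. -/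
structure IsC11 (f : ℝ → ℝ) : Prop where
  contDiff : ContDiff ℝ 1 f
  bounded : ∃ C : ℝ, ∀ r, |f r| ≤ C
  lipschitz : ∃ K, LipschitzWith K f
  lipschitz_deriv : ∃ K, LipschitzWith K (deriv f)

/-- Controls: measurable maps from `ℝ` to the closed unit ball. -/
def IsControl {N : ℕ} (α : ℝ → EuclideanSpace ℝ (Fin N)) : Prop :=
  Measurable α ∧ ∀ s, ‖α s‖ ≤ 1

/-- `X` is a (Carathéodory) solution of `X'(s) = α(s) + V(X(s))` for a.e. `s`, `X(t₀) = x₀`,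
that is, `X` is a locally absolutely continuous function solving the integrated equation. -/
def IsControlledSolution {N : ℕ} (V : EuclideanSpace ℝ (Fin N) → EuclideanSpace ℝ (Fin N))
    (α : ℝ → EuclideanSpace ℝ (Fin N)) (t₀ : ℝ) (x₀ : EuclideanSpace ℝ (Fin N))
    (X : ℝ → EuclideanSpace ℝ (Fin N)) : Prop :=
  ∀ t, IntervalIntegrable (fun s => α s + V (X s)) volume t₀ t ∧
    X t = x₀ + ∫ s in t₀..t, (α s + V (X s))

/-- The set of points that can be reached at time `t` when starting from `x` at time `0`. -/
def reachableSet {N : ℕ} (V : EuclideanSpace ℝ (Fin N) → EuclideanSpace ℝ (Fin N))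
    (t : ℝ) (x : EuclideanSpace ℝ (Fin N)) : Set (EuclideanSpace ℝ (Fin N)) :=
  {y | ∃ α X, IsControl α ∧ IsControlledSolution V α 0 x X ∧ X t = y}

/-- The minimal time `θ(x, y)` to reach `y` from `x`; it is `∞` if `y` cannot be reached. -/
noncomputable def minimalTime {N : ℕ}
    (V : EuclideanSpace ℝ (Fin N) → EuclideanSpace ℝ (Fin N))
    (x y : EuclideanSpace ℝ (Fin N)) : ℝ≥0∞ :=
  ⨅ t ∈ {t : ℝ | 0 ≤ t ∧ y ∈ reachableSet V t x}, ENNReal.ofReal t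

/-- The random planar vector field `V(x, ω) = (0, V₂(x₁, ω))`. -/
noncomputable def shearField {Ω : Type*} (V₂ : ℝ → Ω → ℝ) (x : EuclideanSpace ℝ (Fin 2)) (ω : Ω) :
    EuclideanSpace ℝ (Fin 2) :=
  !₂[0, V₂ (x 0) ω]

/-!
The probability space is a compact abelian group: the closure `PhaseGroup f` of the one-parameter
group `r ↦ (r f₀, r f₁, …)` in the infinite torus `(ℝ/ℤ)^ℕ`, with its Haar probability measure. The
real line acts by translations, and the action is ergodic because the one-parameter group is dense
(`isErgodicEnvironment_phase`). The plane acts through the first coordinate.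

Each phase `g_k` is uniform on the circle and moves at speed `f_k`. Let `b_k ≥ 0` be a bump on the
circle that is at least `3` on a neighbourhood `‖x‖ ≤ w_k` of `0` and has mean at most `2^{-k}/16`,
and let `S = ∑ b_k(g_k)`. Then `E S ≤ 1/8`, so that `S` is finite almost surely, and
`u = 1 - exp (-S)` has mean `m ≤ 1/8`. The field `V₂(r, g)` is `2 (u - m)` at the translate of `g`
by `r`. It has mean `0`, lies in `[-1/4, 2]`, and exceeds `1` wherever `S ≥ 3`. The frequencies
`f_k` are chosen last and very small. On the one hand this makes the first two derivatives of the
bumps along an orbit summable, so that orbits of `V₂` are `C^{1,1}`. On the other hand, on the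
event `‖g_k‖ ≤ w_k / 2`, of probability `w_k`, the field exceeds `1` up to the time `w_k / (2 f_k)`
in both directions. Hence `E δ ≥ w_k² / (2 f_k) ≥ k` for every `k` (`exists_scale`), and `E δ = ∞`.

The distance `δ` is attained since almost every orbit visits `{V₂ < 1}`, by ergodicity and
`E V₂ = 0` (`IsErgodicEnvironment.ae_exists_lt_one`). Finally, `V₂ ≥ -1/4` forces `V₂ > 1` on
`|r| < δ`. There the drift upwards is stronger than any control, so `-e₂` is out of reach from `0`
until the strip `|x₁| < δ` has been left, which takes at least the time `δ` as the horizontal speed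
is at most `1` (`ofReal_le_minimalTime_neg_single`).
-/

/-! ### The time needed to cross a horizontal interval -/

/-- If the vertical drift is at least `1` on the strip `|x₁| < d`, a trajectory from the origin
cannot move down before it has left the strip, and it leaves the strip at horizontal speed at
most `1`. -/
theorem ofReal_le_minimalTime_neg_single {v : ℝ → ℝ} {d : ℝ} (hv : ∀ r, |r| < d → 1 ≤ v r) :
    ENNReal.ofReal d ≤ minimalTime (N := 2) (fun x => !₂[0, v (x 0)]) 0
      (-EuclideanSpace.single 1 1) := by
  refine le_iInf₂ fun t ht => ENNReal.ofReal_le_ofReal ?_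
  obtain ⟨ht0, α, X, hα, hX, hXt⟩ := ht
  by_contra! htd
  have hα_le (i : Fin 2) (s : ℝ) : |α s i| ≤ 1 :=
    (Real.norm_eq_abs _ ▸ PiLp.norm_apply_le (α s) i).trans (hα.2 s)
  have hcoord (i : Fin 2) (s : ℝ) :
      X s i = ∫ u in (0 : ℝ)..s, (α u i + (!₂[0, v (X u 0)] : EuclideanSpace ℝ (Fin 2)) i) := by
    have h := (EuclideanSpace.proj (𝕜 := ℝ) i).intervalIntegral_comp_comm (hX s).1
    have h2 := congrArg (fun y : EuclideanSpace ℝ (Fin 2) => y i) (hX s).2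
    simp only [zero_add] at h2
    rw [h2]
    exact h.symm
  have hX0 (s : ℝ) (hs : 0 ≤ s) : |X s 0| ≤ s := by
    have h0 : X s 0 = ∫ u in (0 : ℝ)..s, α u 0 := by simpa using hcoord 0 s
    rw [h0, ← Real.norm_eq_abs]
    simpa [abs_of_nonneg hs] using
      intervalIntegral.norm_integral_le_of_norm_le_const (a := 0) (b := s)
        (f := fun u => α u 0) (C := 1) fun u _ => by simpa using hα_le 0 u
  have hX1 : X t 1 = ∫ u in (0 : ℝ)..t, (α u 1 + v (X u 0)) := by simpa using hcoord 1 t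
  have hnonneg : 0 ≤ X t 1 := by
    rw [hX1]
    refine intervalIntegral.integral_nonneg ht0 fun u hu => ?_
    have h1 := hv (X u 0) (((hX0 u hu.1).trans hu.2).trans_lt htd)
    have h2 := (abs_le.1 (hα_le 1 u)).1
    linarith
  rw [hXt] at hnonneg
  norm_num at hnonneg

/-! ### Regularity of functions with two bounded derivatives -/

theorem isC11_of_hasDerivAt {g g' g'' : ℝ → ℝ} {C₀ C₁ C₂ : ℝ}
    (h₁ : ∀ r, HasDerivAt g (g' r) r) (h₂ : ∀ r, HasDerivAt g' (g'' r) r)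
    (hC₀ : ∀ r, |g r| ≤ C₀) (hC₁ : ∀ r, |g' r| ≤ C₁) (hC₂ : ∀ r, |g'' r| ≤ C₂) : IsC11 g := by
  have hderiv : deriv g = g' := funext fun r => (h₁ r).deriv
  refine ⟨?_, ⟨C₀, hC₀⟩, ⟨C₁.toNNReal, ?_⟩, ⟨C₂.toNNReal, ?_⟩⟩
  · rw [contDiff_one_iff_deriv, hderiv]
    exact ⟨fun r => (h₁ r).differentiableAt,
      continuous_iff_continuousAt.2 fun r => (h₂ r).continuousAt⟩
  · refine lipschitzWith_of_nnnorm_deriv_le (fun r => (h₁ r).differentiableAt) fun r => ?_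
    rw [(h₁ r).deriv, ← NNReal.coe_le_coe, coe_nnnorm, Real.norm_eq_abs]
    exact (hC₁ r).trans (Real.le_coe_toNNReal _)
  · rw [hderiv]
    refine lipschitzWith_of_nnnorm_deriv_le (fun r => (h₂ r).differentiableAt) fun r => ?_
    rw [(h₂ r).deriv, ← NNReal.coe_le_coe, coe_nnnorm, Real.norm_eq_abs]
    exact (hC₂ r).trans (Real.le_coe_toNNReal _)

/-- Summability of the series itself is needed at one point only; the derivatives are then
summed uniformly. -/
theorem isC11_const_mul_one_sub_exp_neg_tsum_sub {a a' a'' : ℕ → ℝ → ℝ} {u : ℕ → ℝ}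
    (c m : ℝ) (hu : Summable u)
    (h₁ : ∀ k r, HasDerivAt (a k) (a' k r) r) (h₂ : ∀ k r, HasDerivAt (a' k) (a'' k r) r)
    (ha : ∀ k r, 0 ≤ a k r) (ha' : ∀ k r, |a' k r| ≤ u k) (ha'' : ∀ k r, |a'' k r| ≤ u k)
    (h0 : Summable fun k => a k 0) :
    IsC11 (fun r => c * (1 - Real.exp (-∑' k, a k r) - m)) := by
  set S : ℝ → ℝ := fun r => ∑' k, a k r
  set S' : ℝ → ℝ := fun r => ∑' k, a' k r
  set S'' : ℝ → ℝ := fun r => ∑' k, a'' k r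
  set U : ℝ := ∑' k, u k
  have hS : ∀ r, HasDerivAt S (S' r) r := hasDerivAt_tsum hu h₁ ha' h0
  have hS' : ∀ r, HasDerivAt S' (S'' r) r :=
    hasDerivAt_tsum hu h₂ ha'' (.of_norm_bounded hu fun k => ha' k 0)
  have hS'U : ∀ r, |S' r| ≤ U := fun r =>
    tsum_of_norm_bounded (f := fun k => a' k r) hu.hasSum fun k => ha' k r
  have hS''U : ∀ r, |S'' r| ≤ U := fun r =>
    tsum_of_norm_bounded (f := fun k => a'' k r) hu.hasSum fun k => ha'' k r
  have hU : 0 ≤ U := (abs_nonneg _).trans (hS'U 0)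
  have hE : ∀ r, |Real.exp (-S r)| ≤ 1 := fun r => by
    rw [Real.abs_exp, Real.exp_le_one_iff]
    exact neg_nonpos.2 (tsum_nonneg fun k => ha k r)
  have hW (r : ℝ) : HasDerivAt (fun r => Real.exp (-S r)) (-(S' r * Real.exp (-S r))) r := by
    convert! (hS r).fun_neg.exp using 1
    ring
  refine isC11_of_hasDerivAt (g' := fun r => c * (S' r * Real.exp (-S r)))
    (g'' := fun r => c * (S'' r * Real.exp (-S r) - S' r * (S' r * Real.exp (-S r))))
    (C₀ := |c| * (1 + 1 + |m|)) (C₁ := |c| * (U * 1)) (C₂ := |c| * (U * 1 + U * (U * 1)))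
    (fun r => ?_) (fun r => ?_) (fun r => ?_) (fun r => ?_) (fun r => ?_)
  · convert! (((hW r).const_sub 1).sub_const m).const_mul c using 1
    ring
  · convert! ((hS' r).mul (hW r)).const_mul c using 1
    ring
  · rw [abs_mul]
    gcongr
    refine (abs_sub _ _).trans ?_
    gcongr
    refine (abs_sub _ _).trans ?_
    rw [abs_one]
    gcongr
    exact hE r
  · rw [abs_mul, abs_mul]
    gcongr
    exacts [hS'U r, hE r]
  · rw [abs_mul]
    gcongr
    refine (abs_sub _ _).trans ?_
    simp only [abs_mul]
    gcongr
    exacts [hS''U r, hE r, hS'U r, hS'U r, hE r]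

/-! ### Fields along an ergodic real flow -/

/-- A real flow acts on the plane through the first coordinate. -/
theorem IsErgodicEnvironment.comp_fst {Ω : Type*} [MeasurableSpace Ω] {P : Measure Ω}
    {T : ℝ → Ω → Ω} (hT : IsErgodicEnvironment P T) :
    IsErgodicEnvironment P (fun x : EuclideanSpace ℝ (Fin 2) => T (x 0)) where
  measurable_uncurry := hT.measurable_uncurry.comp
    (((EuclideanSpace.proj (𝕜 := ℝ) (0 : Fin 2)).continuous.measurable.comp
      measurable_fst).prodMk measurable_snd)
  measurePreserving x := hT.measurePreserving _
  zero := by simpa using hT.zero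
  add x y := by simpa using hT.add _ _
  ergodic D hD h := hT.ergodic D hD fun z => by simpa using h (EuclideanSpace.single 0 z)

section Flow

variable {Ω : Type*} [MeasurableSpace Ω] {P : Measure Ω} {T : ℝ → Ω → Ω}
  {v : Ω → ℝ}

theorem IsErgodicEnvironment.measurable_field (hT : IsErgodicEnvironment P T)
    (hv : Measurable v) : Measurable (fun p : ℝ × Ω => v (T p.1 p.2)) :=
  hv.comp hT.measurable_uncurry

theorem IsErgodicEnvironment.apply_apply (hT : IsErgodicEnvironment P T) (r s : ℝ) (ω : Ω) :
    T r (T s ω) = T (r + s) ω :=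
  congrFun (hT.add r s) ω

theorem IsErgodicEnvironment.integral_comp (hT : IsErgodicEnvironment P T) (hv : Measurable v)
    (r : ℝ) : ∫ ω, v (T r ω) ∂P = ∫ ω, v ω ∂P := by
  rw [← integral_map (hT.measurePreserving r).measurable.aemeasurable hv.aestronglyMeasurable,
    (hT.measurePreserving r).map_eq]

/-- Almost every orbit visits `{v < 1}` if `v` has mean `0`. The event that an orbit spends
Lebesgue-null time in `{v < 1}` is strictly invariant and measurable, and has not full measure by
Fubini's theorem. -/
theorem IsErgodicEnvironment.ae_exists_lt_one [IsProbabilityMeasure P]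
    (hT : IsErgodicEnvironment P T) (hv : Measurable v) (hint : Integrable v P)
    (hmean : ∫ ω, v ω ∂P = 0) : ∀ᵐ ω ∂P, ∃ r, v (T r ω) < 1 := by
  have hmeas : MeasurableSet {p : ℝ × Ω | v (T p.1 p.2) < 1} :=
    measurableSet_lt (hT.measurable_field hv) measurable_const
  set D : Set Ω := {ω | volume {r | v (T r ω) < 1} = 0}
  have hD : MeasurableSet D := by
    have : Measurable fun ω => volume {r | v (T r ω) < 1} :=
      measurable_measure_prodMk_right hmeas
    exact this (measurableSet_singleton 0)
  have hvol (z : ℝ) (ω : Ω) :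
      volume {r | v (T r (T z ω)) < 1} = volume {r | v (T r ω) < 1} := by
    simp only [hT.apply_apply]
    exact measure_preimage_add_right volume z {r | v (T r ω) < 1}
  have hmem (z : ℝ) (ω : Ω) : T z ω ∈ D ↔ ω ∈ D := by
    change volume _ = 0 ↔ volume _ = 0
    rw [hvol]
  have hinv (z : ℝ) : T z '' D = D := by
    refine Subset.antisymm (image_subset_iff.2 fun ω h => (hmem z ω).2 h) fun ω h => ?_
    refine ⟨T (-z) ω, (hmem _ _).2 h, ?_⟩
    rw [hT.apply_apply, add_neg_cancel, hT.zero, id]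
  rcases hT.ergodic D hD hinv with h0 | h1
  · filter_upwards [measure_eq_zero_iff_ae_notMem.1 h0] with ω hω
    obtain ⟨r, hr⟩ := nonempty_of_measure_ne_zero (show volume {r | v (T r ω) < 1} ≠ 0 from hω)
    exact ⟨r, hr⟩
  · exfalso
    have h2 : ∀ᵐ ω ∂P, ∀ᵐ r : ℝ, ¬ v (T r ω) < 1 := by
      filter_upwards [(mem_ae_iff_prob_eq_one hD).2 h1] with ω hω
      rw [ae_iff]
      simpa only [not_not] using show volume {r | v (T r ω) < 1} = 0 from hω
    obtain ⟨r, hr⟩ := ((Measure.ae_ae_comm hmeas.compl).2 h2).exists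
    have h3 : 1 ≤ ∫ ω, v (T r ω) ∂P := by
      have := integral_mono_ae (integrable_const (1 : ℝ))
        ((hT.measurePreserving r).integrable_comp_of_integrable hint)
        (hr.mono fun ω h => not_lt.1 h)
      simpa using this
    rw [hT.integral_comp hv, hmean] at h3
    linarith

/-- For a continuous field, the distance from `0` to `{r : |v (T r ω)| ≤ 1}` exceeds `c` if and
only if `|v (T q ω)| ≥ 1 + ε` for some rational `ε > 0` and all rational `q` in an interval
`[-c', c']` with rational `c' > c`. -/
theorem IsErgodicEnvironment.nullMeasurable_infDist (hT : IsErgodicEnvironment P T)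
    (hv : Measurable v) (hcont : ∀ᵐ ω ∂P, Continuous fun r => v (T r ω))
    (hne : ∀ᵐ ω ∂P, ∃ r, |v (T r ω)| ≤ 1) :
    NullMeasurable (fun ω => Metric.infDist 0 {r | |v (T r ω)| ≤ 1}) P := by
  suffices h : ∀ c : ℝ, NullMeasurableSet
      ((fun ω => Metric.infDist 0 {r | |v (T r ω)| ≤ 1}) ⁻¹' Ioi c) P by
    have : @Measurable (NullMeasurableSpace Ω P) ℝ _ _
      (fun ω : Ω => Metric.infDist 0 {r | |v (T r ω)| ≤ 1}) := measurable_of_Ioi h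
    exact this
  intro c
  have hq (q : ℚ) : Measurable fun ω => v (T q ω) :=
    (hT.measurable_field hv).comp (measurable_const.prodMk measurable_id)
  have hM : MeasurableSet (⋃ c' : ℚ, ⋃ _ : c < c', ⋃ ε : ℚ, ⋃ _ : 0 < ε, ⋂ q : ℚ,
      ⋂ _ : |(q : ℝ)| ≤ c', {ω | 1 + (ε : ℝ) ≤ |v (T q ω)|}) := by
    refine .iUnion fun c' => .iUnion fun _ => .iUnion fun ε => .iUnion fun _ => .iInter fun q =>
      .iInter fun _ => measurableSet_le measurable_const ?_
    exact (hq q).abs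
  refine hM.nullMeasurableSet.congr ?_
  filter_upwards [hcont, hne] with ω hω hω'
  refine propext ?_
  set g : ℝ → ℝ := fun r => |v (T r ω)|
  have hg : Continuous g := hω.abs
  have hclosed : IsClosed {r | g r ≤ 1} := isClosed_le hg continuous_const
  change ω ∈ ⋃ c' : ℚ, _ ↔ c < Metric.infDist 0 {r | g r ≤ 1}
  simp only [mem_iUnion, mem_iInter, exists_prop]
  change (∃ c' : ℚ, c < c' ∧ ∃ ε : ℚ, 0 < ε ∧ ∀ q : ℚ, |(q : ℝ)| ≤ c' → 1 + (ε : ℝ) ≤ g q) ↔ _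
  obtain ⟨r₀, hr₀, hdist⟩ := hclosed.exists_infDist_eq_dist hω' 0
  rw [hdist]
  simp only [dist_zero_left, Real.norm_eq_abs]
  have hr₀' : g r₀ ≤ 1 := hr₀
  constructor
  · rintro ⟨c', hc', ε, hε, h⟩
    by_contra! hle
    have hopen : IsOpen ({r : ℝ | |r| < c'} ∩ {r | g r < 1 + ε}) :=
      (isOpen_lt continuous_abs continuous_const).inter (isOpen_lt hg continuous_const)
    have hε' : (0 : ℝ) < ε := by exact_mod_cast hε
    obtain ⟨q, h1, h2⟩ := (Rat.denseRange_cast (𝕜 := ℝ)).exists_mem_open hopen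
      ⟨r₀, hle.trans_lt hc', hr₀'.trans_lt (by linarith)⟩
    exact absurd (h q (le_of_lt h1)) (not_le.2 h2)
  · intro hc
    obtain ⟨c', hc', hc''⟩ := exists_rat_btwn hc
    have hgt (r : ℝ) (hr : |r| ≤ c') : 1 < g r := by
      by_contra! hle
      have := Metric.infDist_le_dist_of_mem (x := 0) (show r ∈ {r | g r ≤ 1} from hle)
      rw [hdist] at this
      simp only [dist_zero_left, Real.norm_eq_abs] at this
      linarith
    -- `c` may be negative; the condition on `q` is then vacuous
    by_cases hneg : (c' : ℝ) < 0
    · exact ⟨c', hc', 1, one_pos, fun q hq => absurd (hq.trans_lt hneg) (abs_nonneg _).not_gt⟩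
    obtain ⟨r₁, hr₁, hmin⟩ := (isCompact_Icc (a := -(c' : ℝ)) (b := c')).exists_isMinOn
      ⟨0, by simpa using hneg⟩ hg.continuousOn
    obtain ⟨ε, hε, hε'⟩ := exists_rat_btwn (sub_pos.2 (hgt r₁ (abs_le.2 hr₁)))
    refine ⟨c', hc', ε, by exact_mod_cast hε, fun q hq => ?_⟩
    have := isMinOn_iff.1 hmin q (abs_le.1 hq)
    linarith

/-- A bounded centred function `v ≥ -1` on an ergodic real flow, with `C^{1,1}` orbits and
sufficiently long excursions into `{v > 1}`, gives the required planar field. The events `E k` say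
that the orbit stays in `{v > 1}` up to time `L k` in both directions; they make the expected
distance to `{|v| ≤ 1}` infinite. -/
theorem IsErgodicEnvironment.exists_shear_of_long_excursions [IsProbabilityMeasure P]
    (hT : IsErgodicEnvironment P T)
    (hv : Measurable v) (hle : ∀ ω, |v ω| ≤ 2) (hge : ∀ ω, -1 ≤ v ω) (hmean : ∫ ω, v ω ∂P = 0)
    (hC11 : ∀ᵐ ω ∂P, IsC11 fun r => v (T r ω))
    (E : ℕ → Set Ω) (L : ℕ → ℝ)
    (hE : ∀ k, ∀ᵐ ω ∂P, ω ∈ E k → ∀ r, |r| < L k → 1 < v (T r ω))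
    (hL : ∀ k : ℕ, (k : ℝ≥0∞) ≤ ENNReal.ofReal (L k) * P (E k)) :
    ∃ (τ : EuclideanSpace ℝ (Fin 2) → Ω → Ω) (V₂ : ℝ → Ω → ℝ) (δ : Ω → ℝ),
      IsErgodicEnvironment P τ ∧
      IsErgodicEnvironment P (fun r : ℝ => τ (EuclideanSpace.single 0 r)) ∧
      IsStationaryField P τ (shearField V₂) ∧
      IsStationaryField P (fun r : ℝ => τ (EuclideanSpace.single 0 r)) V₂ ∧
      (∀ r, Integrable (V₂ r) P ∧ ∫ ω, V₂ r ω ∂P = 0) ∧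
      (∀ᵐ ω ∂P, IsC11 (fun r => V₂ r ω)) ∧
      (∀ᵐ ω ∂P, ∀ r, |V₂ r ω| ≤ 2) ∧
      Measurable δ ∧
      (∀ᵐ ω ∂P, IsLeast {s : ℝ | ∃ r : ℝ, |V₂ r ω| ≤ 1 ∧ s = |r|} (δ ω)) ∧
      ∫⁻ ω, ENNReal.ofReal (δ ω) ∂P = ∞ ∧
      ∫⁻ ω, minimalTime (fun x => shearField V₂ x ω) 0 (-EuclideanSpace.single 1 1) ∂P = ∞ := by
  have hint : Integrable v P :=
    .of_bound hv.aestronglyMeasurable 2 (.of_forall fun ω => hle ω)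
  have hcont : ∀ᵐ ω ∂P, Continuous fun r => v (T r ω) := hC11.mono fun ω h => h.contDiff.continuous
  have hne : ∀ᵐ ω ∂P, ∃ r, |v (T r ω)| ≤ 1 :=
    (hT.ae_exists_lt_one hv hint hmean).mono fun ω ⟨r, hr⟩ => ⟨r, abs_le.2 ⟨hge _, hr.le⟩⟩
  have hδ : AEMeasurable (fun ω => Metric.infDist 0 {r | |v (T r ω)| ≤ 1}) P :=
    (hT.nullMeasurable_infDist hv hcont hne).aemeasurable
  have hleast : ∀ᵐ ω ∂P, IsLeast {s : ℝ | ∃ r : ℝ, |v (T r ω)| ≤ 1 ∧ s = |r|} (hδ.mk _ ω) := by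
    filter_upwards [hcont, hne, hδ.ae_eq_mk] with ω hω hω' hmk
    rw [← hmk]
    have hclosed : IsClosed {r | |v (T r ω)| ≤ 1} := isClosed_le hω.abs continuous_const
    obtain ⟨r₀, hr₀, hdist⟩ := hclosed.exists_infDist_eq_dist hω' 0
    refine ⟨⟨r₀, hr₀, by simpa using hdist⟩, ?_⟩
    rintro _ ⟨r, hr, rfl⟩
    simpa using Metric.infDist_le_dist_of_mem (x := 0) (show r ∈ {r | |v (T r ω)| ≤ 1} from hr)
  have hδ_top : ∫⁻ ω, ENNReal.ofReal (hδ.mk _ ω) ∂P = ∞ := by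
    refine ENNReal.eq_top_of_forall_nnreal_le fun b => ?_
    obtain ⟨k, hk⟩ := exists_nat_ge b
    -- Markov's inequality at the level `L k`, since `δ ≥ L k` on `E k`
    calc (b : ℝ≥0∞) ≤ k := by exact_mod_cast hk
      _ ≤ ENNReal.ofReal (L k) * P (E k) := hL k
      _ ≤ ENNReal.ofReal (L k) * P {ω | ENNReal.ofReal (L k) ≤ ENNReal.ofReal (hδ.mk _ ω)} := by
        gcongr 1
        refine measure_mono_ae ?_
        filter_upwards [hE k, hleast] with ω hω hω' hmem
        obtain ⟨r, hr, hr'⟩ := hω'.1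
        refine ENNReal.ofReal_le_ofReal (hr' ▸ ?_)
        by_contra! hlt
        exact absurd ((le_abs_self _).trans hr) (not_le.2 (hω hmem r hlt))
      _ ≤ _ := mul_meas_ge_le_lintegral hδ.measurable_mk.ennreal_ofReal _
  have hTsingle :
      (fun r : ℝ => T ((EuclideanSpace.single 0 r : EuclideanSpace ℝ (Fin 2)) 0)) = T := by
    funext r
    simp
  refine ⟨fun x => T (x 0), fun r ω => v (T r ω), hδ.mk _, hT.comp_fst, ?_, ⟨?_, ?_⟩, ⟨?_, ?_⟩,
    fun r => ⟨?_, ?_⟩, hC11, .of_forall fun ω r => hle _, hδ.measurable_mk, hleast, hδ_top, ?_⟩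
  · rwa [hTsingle]
  · have h : Measurable fun p : EuclideanSpace ℝ (Fin 2) × Ω => v (T (p.1 0) p.2) :=
      hv.comp hT.comp_fst.measurable_uncurry
    refine (PiLp.continuous_toLp 2 _).measurable.comp (measurable_pi_lambda _ fun i => ?_)
    fin_cases i
    · exact measurable_const
    · exact h
  · exact .of_forall fun ω y z => by simp [shearField, hT.apply_apply]
  · exact hT.measurable_field hv
  · exact .of_forall fun ω y z => by simp [hT.apply_apply]
  · exact (hT.measurePreserving r).integrable_comp_of_integrable hint
  · rw [hT.integral_comp hv, hmean]
  · refine eq_top_mono (lintegral_mono_ae ?_) hδ_top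
    filter_upwards [hleast] with ω hω
    refine ofReal_le_minimalTime_neg_single (v := fun r => v (T r ω)) fun r hr => ?_
    by_contra! hlt
    exact absurd (hω.2 ⟨r, abs_le.2 ⟨hge _, hlt.le⟩, rfl⟩) (not_le.2 hr)

end Flow

/-! ### Bumps on the circle -/

/-- A positive function on the circle that equals `4` at `0` and concentrates there as `n` grows:
`4 exp (-n (1 - cos (2πt)))` in the coordinate `t`. -/
noncomputable def circleBump (n : ℕ) (x : UnitAddCircle) : ℝ :=
  4 * Real.exp (-(n * (1 - (x.toCircle : ℂ).re)))

theorem circleBump_coe (n : ℕ) (t : ℝ) :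
    circleBump n (t : UnitAddCircle) = 4 * Real.exp (-(n * (1 - Real.cos (2 * Real.pi * t)))) := by
  rw [circleBump, AddCircle.toCircle_apply_mk, Circle.coe_exp, Complex.exp_ofReal_mul_I_re, div_one]

theorem continuous_circleBump (n : ℕ) : Continuous (circleBump n) := by
  have : Continuous fun x : UnitAddCircle => (x.toCircle : ℂ).re :=
    Complex.continuous_re.comp (continuous_subtype_val.comp AddCircle.continuous_toCircle)
  unfold circleBump
  fun_prop

theorem circleBump_nonneg (n : ℕ) (x : UnitAddCircle) : 0 ≤ circleBump n x := by
  unfold circleBump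
  positivity

theorem circleBump_le (n : ℕ) (x : UnitAddCircle) : circleBump n x ≤ 4 := by
  induction x using QuotientAddGroup.induction_on with | H t =>
  rw [circleBump_coe]
  have h := Real.cos_le_one (2 * Real.pi * t)
  have : Real.exp (-(n * (1 - Real.cos (2 * Real.pi * t)))) ≤ 1 :=
    Real.exp_le_one_iff.2 (neg_nonpos.2 (mul_nonneg n.cast_nonneg (by linarith)))
  linarith

open Filter Topology in
theorem tendsto_lintegral_circleBump :
    Tendsto (fun n => ∫⁻ x, ENNReal.ofReal (circleBump n x)) atTop (𝓝 0) := by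
  have h := tendsto_lintegral_of_dominated_convergence (μ := (volume : Measure UnitAddCircle))
    (F := fun n x => ENNReal.ofReal (circleBump n x)) (f := fun _ => 0) (fun _ => 4)
    (fun n => (continuous_circleBump n).measurable.ennreal_ofReal)
    (fun n => .of_forall fun x => by simpa using ENNReal.ofReal_le_ofReal (circleBump_le n x))
    (by simp) ?_
  · simpa using h
  have h0 : ∀ᵐ x : UnitAddCircle, x ≠ 0 := by
    rw [ae_iff]
    simpa using AddCircle.volume_closedBall 1 (x := (0 : UnitAddCircle)) 0
  filter_upwards [h0] with x hx
  have hre : (x.toCircle : ℂ).re < 1 := by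
    refine lt_of_le_of_ne ((Complex.re_le_norm _).trans (Circle.norm_coe _).le) fun h => hx ?_
    refine AddCircle.injective_toCircle one_ne_zero ?_
    rw [AddCircle.toCircle_zero]
    have hn := x.toCircle.normSq_coe
    rw [Complex.normSq_apply, h] at hn
    refine Circle.ext (Complex.ext (by simpa using h) ?_)
    simpa using hn
  rw [← ENNReal.ofReal_zero]
  refine ENNReal.tendsto_ofReal ?_
  have h1 : Tendsto (fun n : ℕ => (n : ℝ) * (1 - (x.toCircle : ℂ).re)) atTop atTop :=
    tendsto_natCast_atTop_atTop.atTop_mul_const (sub_pos.2 hre)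
  simpa [circleBump] using (Real.tendsto_exp_neg_atTop_nhds_zero.comp h1).const_mul 4

/-! ### Bumps along a rotation of the circle -/

/-- First derivative of `r ↦ circleBump n (r * f + t)`, with `c = 2πf` and `θ = 2πt`. -/
noncomputable def bumpDeriv (n : ℕ) (c θ r : ℝ) : ℝ :=
  -(n * c * Real.sin (c * r + θ)) * (4 * Real.exp (-(n * (1 - Real.cos (c * r + θ)))))

/-- Second derivative of `r ↦ circleBump n (r * f + t)`, with `c = 2πf` and `θ = 2πt`. -/
noncomputable def bumpDeriv2 (n : ℕ) (c θ r : ℝ) : ℝ :=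
  ((n * c * Real.sin (c * r + θ)) ^ 2 - n * c ^ 2 * Real.cos (c * r + θ)) *
    (4 * Real.exp (-(n * (1 - Real.cos (c * r + θ)))))

theorem hasDerivAt_bump (n : ℕ) (c θ r : ℝ) :
    HasDerivAt (fun r => 4 * Real.exp (-(n * (1 - Real.cos (c * r + θ)))))
      (bumpDeriv n c θ r) r := by
  have h : HasDerivAt (fun r => c * r + θ) c r := by
    simpa using ((hasDerivAt_id r).const_mul c).add_const θ
  convert! (((h.cos.const_sub 1).const_mul (n : ℝ)).fun_neg.exp).const_mul 4 using 1
  rw [bumpDeriv]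
  ring

theorem hasDerivAt_bumpDeriv (n : ℕ) (c θ r : ℝ) :
    HasDerivAt (bumpDeriv n c θ) (bumpDeriv2 n c θ r) r := by
  have h : HasDerivAt (fun r => c * r + θ) c r := by
    simpa using ((hasDerivAt_id r).const_mul c).add_const θ
  convert! ((h.sin.const_mul (n * c)).fun_neg).fun_mul (hasDerivAt_bump n c θ r) using 1
  rw [bumpDeriv2, bumpDeriv]
  ring

theorem abs_four_mul_exp_le (n : ℕ) (y : ℝ) :
    |4 * Real.exp (-(n * (1 - Real.cos y)))| ≤ 4 := by
  have : Real.exp (-(n * (1 - Real.cos y))) ≤ 1 :=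
    Real.exp_le_one_iff.2
      (neg_nonpos.2 (mul_nonneg n.cast_nonneg (sub_nonneg.2 (Real.cos_le_one y))))
  rw [abs_of_nonneg (by positivity)]
  linarith

theorem abs_bumpDeriv_le (n : ℕ) {c : ℝ} (hc : 0 ≤ c) (θ r : ℝ) :
    |bumpDeriv n c θ r| ≤ 4 * (n * c) := by
  have hs : |(n * c) * Real.sin (c * r + θ)| ≤ n * c * 1 := by
    rw [abs_mul, abs_of_nonneg (by positivity : 0 ≤ n * c)]
    gcongr
    exact Real.abs_sin_le_one _
  rw [bumpDeriv, abs_mul, abs_neg]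
  have := mul_le_mul hs (abs_four_mul_exp_le n (c * r + θ)) (abs_nonneg _) (by positivity)
  linarith

theorem abs_bumpDeriv2_le (n : ℕ) (c θ r : ℝ) :
    |bumpDeriv2 n c θ r| ≤ 4 * ((n * c) ^ 2 + n * c ^ 2) := by
  have hs : |(n * c * Real.sin (c * r + θ)) ^ 2 - n * c ^ 2 * Real.cos (c * r + θ)| ≤
      (n * c) ^ 2 * 1 + n * c ^ 2 * 1 := by
    refine (abs_sub _ _).trans ?_
    rw [mul_pow, abs_mul, abs_mul, abs_of_nonneg (by positivity : 0 ≤ (n * c) ^ 2),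
      abs_of_nonneg (by positivity : 0 ≤ n * c ^ 2)]
    gcongr
    · rw [abs_of_nonneg (sq_nonneg _)]
      exact Real.sin_sq_le_one _
    · exact Real.abs_cos_le_one _
  rw [bumpDeriv2, abs_mul]
  have := mul_le_mul hs (abs_four_mul_exp_le n (c * r + θ)) (abs_nonneg _) (by positivity)
  linarith

/-! ### Choice of the scales -/

/-- The parameters of one scale: `n` makes the bump small in mean, `w` is the radius of a
neighbourhood of `0` where the bump is at least `3`, and the frequency `f` is chosen last, so small
that the bump varies slowly along the rotation and that the rotation needs a time of at least
`k / w` to move by `w / 2`. -/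
theorem exists_scale (k : ℕ) : ∃ (n : ℕ) (w f : ℝ),
    ∫⁻ x, ENNReal.ofReal (circleBump n x) ≤ ENNReal.ofReal ((1 / 2) ^ k / 16) ∧
    0 < w ∧ w ≤ 1 / 2 ∧ (∀ x : UnitAddCircle, ‖x‖ ≤ w → 3 ≤ circleBump n x) ∧
    0 < f ∧ 4 * (2 * Real.pi * f) * (n + 1) ≤ (1 / 2) ^ k ∧ k * (2 * f) ≤ w ^ 2 := by
  obtain ⟨n, hn⟩ := (tendsto_lintegral_circleBump.eventually_le_const
    (u := ENNReal.ofReal ((1 / 2) ^ k / 16)) (by positivity)).exists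
  obtain ⟨ε, hε, hball⟩ := Metric.continuousAt_iff.1
    ((continuous_circleBump n).continuousAt (x := 0)) 1 one_pos
  have h0 : circleBump n 0 = 4 := by simp [circleBump]
  set w := min (ε / 2) (1 / 2) with hw
  have hw0 : 0 < w := by positivity
  set A : ℝ := 4 * (2 * Real.pi) * (n + 1) with hA
  have hA0 : 0 < A := by positivity
  refine ⟨n, w, min ((1 / 2) ^ k / A) (w ^ 2 / (2 * (k + 1))), hn, hw0, min_le_right _ _,
    fun x hx => ?_, by positivity, ?_, ?_⟩
  · have hx' : dist x 0 < ε := by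
      rw [dist_zero_right]
      linarith [min_le_left (ε / 2) (1 / 2)]
    have := hball hx'
    rw [h0, Real.dist_eq, abs_lt] at this
    linarith
  · calc _ = min ((1 / 2) ^ k / A) (w ^ 2 / (2 * (k + 1))) * A := by rw [hA]; ring
      _ ≤ (1 / 2) ^ k / A * A := by gcongr; exact min_le_left _ _
      _ = (1 / 2) ^ k := by field_simp
  · calc (k : ℝ) * (2 * min ((1 / 2) ^ k / A) (w ^ 2 / (2 * (k + 1))))
        ≤ (k + 1) * (2 * (w ^ 2 / (2 * (k + 1)))) := by
          gcongr
          · linarith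
          · exact min_le_right _ _
      _ = w ^ 2 := by field_simp

/-! ### The group of phases -/

/-- The one-parameter group `r ↦ (r f_k mod 1)_k` of the infinite torus. -/
noncomputable def phaseHom (f : ℕ → ℝ) : ℝ →+ (ℕ → UnitAddCircle) where
  toFun r k := ((r * f k : ℝ) : UnitAddCircle)
  map_zero' := by ext; simp
  map_add' r s := by ext; simp [add_mul]

theorem continuous_phaseHom (f : ℕ → ℝ) : Continuous (phaseHom f) :=
  continuous_pi fun _ => (AddCircle.continuous_mk' 1).comp (continuous_id.mul continuous_const)

/-- The closure of the one-parameter group `phaseHom f`, a compact abelian group. -/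
noncomputable abbrev PhaseGroup (f : ℕ → ℝ) : AddSubgroup (ℕ → UnitAddCircle) :=
  (phaseHom f).range.topologicalClosure

instance (f : ℕ → ℝ) : CompactSpace (PhaseGroup f) :=
  isCompact_iff_compactSpace.1 (AddSubgroup.isClosed_topologicalClosure _).isCompact

instance (f : ℕ → ℝ) : SecondCountableTopology (PhaseGroup f) :=
  TopologicalSpace.Subtype.secondCountableTopology _

/-- The Haar probability measure of the group of phases. -/
noncomputable def phaseMeasure (f : ℕ → ℝ) : Measure (PhaseGroup f) :=
  Measure.addHaarMeasure ⊤

instance (f : ℕ → ℝ) : (phaseMeasure f).IsAddHaarMeasure := by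
  unfold phaseMeasure; infer_instance

instance (f : ℕ → ℝ) : IsProbabilityMeasure (phaseMeasure f) :=
  ⟨Measure.addHaarMeasure_self (K₀ := (⊤ : TopologicalSpace.PositiveCompacts (PhaseGroup f)))⟩

/-- The one-parameter group, as a map to the group of phases. -/
noncomputable def phasePath (f : ℕ → ℝ) (r : ℝ) : PhaseGroup f :=
  ⟨phaseHom f r, subset_closure ⟨r, rfl⟩⟩

theorem continuous_phasePath (f : ℕ → ℝ) : Continuous (phasePath f) :=
  (continuous_phaseHom f).subtype_mk _

theorem denseRange_phasePath (f : ℕ → ℝ) : DenseRange (phasePath f) := by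
  intro x
  rw [closure_subtype]
  convert! x.2 using 1
  rw [← range_comp]
  rfl

/-- Translations by a dense set of elements act ergodically on a compact group. -/
theorem measure_eq_zero_or_one_of_dense_setOf_preimage_add_eq {G : Type*} [AddGroup G]
    [TopologicalSpace G] [IsTopologicalAddGroup G] [SecondCountableTopology G]
    [MeasurableSpace G] [BorelSpace G] {μ : Measure G} [IsProbabilityMeasure μ]
    [μ.InnerRegular] [μ.IsAddLeftInvariant] {D : Set G} (hD : MeasurableSet D)
    (hd : Dense {g : G | (g + ·) ⁻¹' D = D}) : μ D = 0 ∨ μ D = 1 := by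
  have h := aeconst_of_dense_setOfPred_preimage_vadd_eq (M := G) (μ := μ) hD.nullMeasurableSet hd
  rcases Filter.eventuallyConst_set.1 h with h | h
  · exact .inr ((mem_ae_iff_prob_eq_one hD).1 h)
  · exact .inl (measure_eq_zero_iff_ae_notMem.2 h)

theorem isErgodicEnvironment_phase (f : ℕ → ℝ) :
    IsErgodicEnvironment (phaseMeasure f) (fun r g => phasePath f r + g) where
  measurable_uncurry := by
    have : Continuous fun p : ℝ × PhaseGroup f => phasePath f p.1 + p.2 :=
      ((continuous_phasePath f).comp continuous_fst).add continuous_snd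
    exact this.measurable
  measurePreserving r := measurePreserving_add_left _ _
  zero := by
    funext g
    have : phasePath f 0 = 0 := Subtype.ext (map_zero (phaseHom f))
    simp [this]
  add r s := by
    funext g
    have : phasePath f (r + s) = phasePath f r + phasePath f s :=
      Subtype.ext (map_add (phaseHom f) r s)
    simp [this, add_assoc]
  ergodic D hD hinv := by
    have hpre (r : ℝ) : (phasePath f r + ·) ⁻¹' D = D := by
      conv_lhs => rw [← hinv r]
      exact preimage_image_eq D (add_right_injective _)
    exact measure_eq_zero_or_one_of_dense_setOf_preimage_add_eq hD
      ((denseRange_phasePath f).mono (range_subset_iff.2 hpre))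

/-- Each phase is uniformly distributed on the circle. -/
theorem measurePreserving_phase (f : ℕ → ℝ) (k : ℕ) (hf : f k ≠ 0) :
    MeasurePreserving (fun g : PhaseGroup f => (g : ℕ → UnitAddCircle) k)
      (phaseMeasure f) volume := by
  let χ : PhaseGroup f →+ UnitAddCircle :=
    (Pi.evalAddMonoidHom (fun _ : ℕ => UnitAddCircle) k).comp (PhaseGroup f).subtype
  have hχ : Continuous χ := (continuous_apply k).comp continuous_subtype_val
  refine AddMonoidHom.measurePreserving (f := χ) hχ (fun x => ?_) (by simp)
  induction x using QuotientAddGroup.induction_on with | H t =>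
  refine ⟨phasePath f (t / f k), ?_⟩
  change ((t / f k * f k : ℝ) : UnitAddCircle) = t
  rw [div_mul_cancel₀ _ hf]

/-! ### The sum of bumps over all scales -/

/-- The sum of the bumps of all phases. It is summed in `ℝ≥0∞`, so that its integral
is the sum of the integrals of the bumps. Where the series diverges, which happens on a null set
only, the value is the junk value `0`. -/
noncomputable def bumpSum (n : ℕ → ℕ) (f : ℕ → ℝ) (g : PhaseGroup f) : ℝ :=
  (∑' k, ENNReal.ofReal (circleBump (n k) (g.1 k))).toReal

theorem bumpSum_eq_tsum (n : ℕ → ℕ) (f : ℕ → ℝ) (g : PhaseGroup f) :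
    bumpSum n f g = ∑' k, circleBump (n k) (g.1 k) := by
  rw [bumpSum, ENNReal.tsum_toReal_eq fun _ => ENNReal.ofReal_ne_top]
  simp only [ENNReal.toReal_ofReal (circleBump_nonneg _ _)]

theorem bumpSum_nonneg (n : ℕ → ℕ) (f : ℕ → ℝ) (g : PhaseGroup f) : 0 ≤ bumpSum n f g :=
  ENNReal.toReal_nonneg

theorem measurable_ofReal_circleBump_phase (m : ℕ) (f : ℕ → ℝ) (k : ℕ) :
    Measurable fun g : PhaseGroup f => ENNReal.ofReal (circleBump m (g.1 k)) :=
  ((continuous_circleBump m).comp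
    ((continuous_apply k).comp continuous_subtype_val)).measurable.ennreal_ofReal

theorem measurable_bumpSum (n : ℕ → ℕ) (f : ℕ → ℝ) : Measurable (bumpSum n f) :=
  (Measurable.tsum fun k => measurable_ofReal_circleBump_phase (n k) f k).ennreal_toReal

section Scales

variable {n : ℕ → ℕ} {f : ℕ → ℝ}

theorem lintegral_tsum_circleBump_le (hf : ∀ k, 0 < f k)
    (hn : ∀ k, ∫⁻ x, ENNReal.ofReal (circleBump (n k) x) ≤ ENNReal.ofReal ((1 / 2) ^ k / 16)) :
    ∫⁻ g : PhaseGroup f, ∑' k, ENNReal.ofReal (circleBump (n k) (g.1 k)) ∂phaseMeasure f ≤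
      ENNReal.ofReal (1 / 8) := by
  rw [lintegral_tsum fun k => (measurable_ofReal_circleBump_phase (n k) f k).aemeasurable]
  calc _ ≤ ∑' k : ℕ, ENNReal.ofReal ((1 / 2) ^ k / 16) := by
        refine ENNReal.tsum_le_tsum fun k => ?_
        refine le_of_eq_of_le ?_ (hn k)
        exact (measurePreserving_phase f k (hf k).ne').lintegral_comp
          (continuous_circleBump (n k)).measurable.ennreal_ofReal
    _ = ENNReal.ofReal (∑' k : ℕ, (1 / 2) ^ k / 16) :=
        (ENNReal.ofReal_tsum_of_nonneg (fun k => by positivity)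
          (summable_geometric_two.div_const 16)).symm
    _ = ENNReal.ofReal (1 / 8) := by
        rw [tsum_div_const, tsum_geometric_two]
        norm_num

theorem ae_summable_circleBump (hf : ∀ k, 0 < f k)
    (hn : ∀ k, ∫⁻ x, ENNReal.ofReal (circleBump (n k) x) ≤ ENNReal.ofReal ((1 / 2) ^ k / 16)) :
    ∀ᵐ g ∂phaseMeasure f, Summable fun k => circleBump (n k) (g.1 k) := by
  have h := ae_lt_top
    (Measurable.tsum fun k => measurable_ofReal_circleBump_phase (n k) f k)
    ((lintegral_tsum_circleBump_le hf hn).trans_lt ENNReal.ofReal_lt_top).ne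
  filter_upwards [h] with g hg
  simpa only [ENNReal.toReal_ofReal (circleBump_nonneg _ _)] using ENNReal.summable_toReal hg.ne

theorem integrable_bumpSum (hf : ∀ k, 0 < f k)
    (hn : ∀ k, ∫⁻ x, ENNReal.ofReal (circleBump (n k) x) ≤ ENNReal.ofReal ((1 / 2) ^ k / 16)) :
    Integrable (bumpSum n f) (phaseMeasure f) :=
  integrable_toReal_of_lintegral_ne_top
    (Measurable.tsum fun k => measurable_ofReal_circleBump_phase (n k) f k).aemeasurable
    ((lintegral_tsum_circleBump_le hf hn).trans_lt ENNReal.ofReal_lt_top).ne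

theorem integral_bumpSum_le (hf : ∀ k, 0 < f k)
    (hn : ∀ k, ∫⁻ x, ENNReal.ofReal (circleBump (n k) x) ≤ ENNReal.ofReal ((1 / 2) ^ k / 16)) :
    ∫ g, bumpSum n f g ∂phaseMeasure f ≤ 1 / 8 := by
  have hle := lintegral_tsum_circleBump_le hf hn
  have hmeas : Measurable fun g : PhaseGroup f =>
      ∑' k, ENNReal.ofReal (circleBump (n k) (g.1 k)) :=
    Measurable.tsum fun k => measurable_ofReal_circleBump_phase (n k) f k
  unfold bumpSum
  rw [integral_toReal hmeas.aemeasurable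
    (ae_lt_top hmeas (hle.trans_lt ENNReal.ofReal_lt_top).ne)]
  exact ENNReal.toReal_le_of_le_ofReal (by norm_num) hle

theorem circleBump_phasePath_add (m : ℕ) (g : PhaseGroup f) (k : ℕ) {t : ℝ}
    (ht : (t : UnitAddCircle) = g.1 k) (r : ℝ) :
    circleBump m ((phasePath f r + g).1 k) =
      4 * Real.exp (-(m * (1 - Real.cos (2 * Real.pi * f k * r + 2 * Real.pi * t)))) := by
  have h : (phasePath f r + g).1 k = ((r * f k + t : ℝ) : UnitAddCircle) := by
    rw [AddCircle.coe_add, ht]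
    rfl
  rw [h, circleBump_coe]
  ring_nf

theorem abs_bumpDeriv_le_geometric (hf : ∀ k, 0 < f k)
    (hfn : ∀ k, 4 * (2 * Real.pi * f k) * (n k + 1) ≤ (1 / 2) ^ k) (k : ℕ) (θ r : ℝ) :
    |bumpDeriv (n k) (2 * Real.pi * f k) θ r| ≤ (1 / 2) ^ k := by
  have hc : 0 ≤ 2 * Real.pi * f k := by have := hf k; positivity
  refine (abs_bumpDeriv_le _ hc _ _).trans ((hfn k).trans' ?_)
  nlinarith

theorem abs_bumpDeriv2_le_geometric (hf : ∀ k, 0 < f k)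
    (hfn : ∀ k, 4 * (2 * Real.pi * f k) * (n k + 1) ≤ (1 / 2) ^ k) (k : ℕ) (θ r : ℝ) :
    |bumpDeriv2 (n k) (2 * Real.pi * f k) θ r| ≤ (1 / 2) ^ k := by
  have hc : 0 ≤ 2 * Real.pi * f k := by have := hf k; positivity
  refine (abs_bumpDeriv2_le _ _ _ _).trans ((hfn k).trans' ?_)
  have h1 : (2 * Real.pi * f k) * (n k + 1) ≤ 1 := by
    have := (hfn k).trans (pow_le_one₀ (by norm_num) (by norm_num))
    linarith
  calc 4 * ((n k * (2 * Real.pi * f k)) ^ 2 + n k * (2 * Real.pi * f k) ^ 2)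
      ≤ 4 * ((2 * Real.pi * f k) * (n k + 1)) * ((2 * Real.pi * f k) * (n k + 1)) := by
        have : (0 : ℝ) ≤ n k := Nat.cast_nonneg _
        nlinarith [mul_nonneg this (sq_nonneg (2 * Real.pi * f k)),
          sq_nonneg (2 * Real.pi * f k)]
    _ ≤ 4 * ((2 * Real.pi * f k) * (n k + 1)) * 1 := by gcongr
    _ = 4 * (2 * Real.pi * f k) * (n k + 1) := by ring

/-- If the series of bumps converges at one point of an orbit, it converges on the whole orbit,
because the derivatives along the orbit are summable. -/
theorem summable_circleBump_phasePath_add (hf : ∀ k, 0 < f k)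
    (hfn : ∀ k, 4 * (2 * Real.pi * f k) * (n k + 1) ≤ (1 / 2) ^ k) {g : PhaseGroup f}
    (hg : Summable fun k => circleBump (n k) (g.1 k)) (r : ℝ) :
    Summable fun k => circleBump (n k) ((phasePath f r + g).1 k) := by
  choose t ht using fun k => QuotientAddGroup.mk_surjective (g.1 k)
  have h0 : phasePath f 0 + g = g := congrFun (isErgodicEnvironment_phase f).zero g
  rw [← h0] at hg
  simp only [fun k => circleBump_phasePath_add (n k) g k (ht k)] at hg ⊢
  exact summable_of_summable_hasDerivAt summable_geometric_two
    (fun k r => hasDerivAt_bump (n k) (2 * Real.pi * f k) (2 * Real.pi * t k) r)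
    (fun k r => abs_bumpDeriv_le_geometric hf hfn k _ r) hg r

theorem isC11_const_mul_one_sub_exp_neg_bumpSum_sub (hf : ∀ k, 0 < f k)
    (hfn : ∀ k, 4 * (2 * Real.pi * f k) * (n k + 1) ≤ (1 / 2) ^ k) {g : PhaseGroup f}
    (hg : Summable fun k => circleBump (n k) (g.1 k)) (c m : ℝ) :
    IsC11 fun r => c * (1 - Real.exp (-bumpSum n f (phasePath f r + g)) - m) := by
  choose t ht using fun k => QuotientAddGroup.mk_surjective (g.1 k)
  have h0 : phasePath f 0 + g = g := congrFun (isErgodicEnvironment_phase f).zero g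
  rw [← h0] at hg
  simp only [bumpSum_eq_tsum, fun k => circleBump_phasePath_add (n k) g k (ht k)] at hg ⊢
  exact isC11_const_mul_one_sub_exp_neg_tsum_sub c m summable_geometric_two
    (fun k r => hasDerivAt_bump (n k) (2 * Real.pi * f k) (2 * Real.pi * t k) r)
    (fun k r => hasDerivAt_bumpDeriv (n k) (2 * Real.pi * f k) (2 * Real.pi * t k) r)
    (fun k r => by positivity)
    (fun k r => abs_bumpDeriv_le_geometric hf hfn k _ r)
    (fun k r => abs_bumpDeriv2_le_geometric hf hfn k _ r) hg

/-- As long as the `k`-th phase is `w`-close to `0`, the `k`-th bump alone makes the sum large. -/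
theorem three_le_bumpSum (hf : ∀ k, 0 < f k)
    (hfn : ∀ k, 4 * (2 * Real.pi * f k) * (n k + 1) ≤ (1 / 2) ^ k) {g : PhaseGroup f}
    (hg : Summable fun k => circleBump (n k) (g.1 k)) {k : ℕ} {w : ℝ}
    (hw : ∀ x : UnitAddCircle, ‖x‖ ≤ w → 3 ≤ circleBump (n k) x)
    (hgk : ‖g.1 k‖ ≤ w / 2) {r : ℝ} (hr : |r| < w / (2 * f k)) :
    3 ≤ bumpSum n f (phasePath f r + g) := by
  rw [bumpSum_eq_tsum]
  refine (hw _ ?_).trans ((summable_circleBump_phasePath_add hf hfn hg r).le_tsum k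
    fun _ _ => circleBump_nonneg _ _)
  have h1 : ‖((r * f k : ℝ) : UnitAddCircle)‖ ≤ w / 2 := by
    calc _ ≤ |r * f k| := QuotientAddGroup.norm_mk_le_norm
      _ = |r| * f k := by rw [abs_mul, abs_of_pos (hf k)]
      _ ≤ w / (2 * f k) * f k := by have := hf k; gcongr
      _ = w / 2 := by have := hf k; field_simp
  have h2 : (phasePath f r + g).1 k = ((r * f k : ℝ) : UnitAddCircle) + g.1 k := rfl
  rw [h2]
  linarith [norm_add_le ((r * f k : ℝ) : UnitAddCircle) (g.1 k)]

end Scales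

/-! ### The random shear field -/

theorem mainTheorem5 :
    ∃ (Ω : Type) (_ : MeasurableSpace Ω) (P : Measure Ω) (_ : IsProbabilityMeasure P)
      (τ : EuclideanSpace ℝ (Fin 2) → Ω → Ω) (V₂ : ℝ → Ω → ℝ) (δ : Ω → ℝ),
      -- the planar environment, and its horizontal translations, are ergodic
      IsErgodicEnvironment P τ ∧
      IsErgodicEnvironment P (fun r : ℝ => τ (EuclideanSpace.single 0 r)) ∧
      -- `V = (0, V₂)` and `V₂` are stationary
      IsStationaryField P τ (shearField V₂) ∧
      IsStationaryField P (fun r : ℝ => τ (EuclideanSpace.single 0 r)) V₂ ∧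
      -- mean zero, `C^{1,1}` regularity and the bound `‖V₂‖ ≤ 2`
      (∀ r, Integrable (V₂ r) P ∧ ∫ ω, V₂ r ω ∂P = 0) ∧
      (∀ᵐ ω ∂P, IsC11 (fun r => V₂ r ω)) ∧
      (∀ᵐ ω ∂P, ∀ r, |V₂ r ω| ≤ 2) ∧
      -- `δ(ω) = min {|r| : |V₂(r, ω)| ≤ 1}` has infinite expectation
      Measurable δ ∧
      (∀ᵐ ω ∂P, IsLeast {s : ℝ | ∃ r : ℝ, |V₂ r ω| ≤ 1 ∧ s = |r|} (δ ω)) ∧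
      ∫⁻ ω, ENNReal.ofReal (δ ω) ∂P = ∞ ∧
      -- the minimal time to `e₂` or to `-e₂` has infinite expectation
      (∫⁻ ω, minimalTime (fun x => shearField V₂ x ω) 0 (EuclideanSpace.single 1 1) ∂P = ∞ ∨
        ∫⁻ ω, minimalTime (fun x => shearField V₂ x ω) 0 (-EuclideanSpace.single 1 1) ∂P = ∞) := by
  choose n w f hn hw0 hw1 hw hf hfn hfw using exists_scale
  have hsum := ae_summable_circleBump hf hn
  set u : PhaseGroup f → ℝ := fun g => 1 - Real.exp (-bumpSum n f g) with hu_def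
  have hu : Measurable u :=
    measurable_const.sub (Real.measurable_exp.comp (measurable_bumpSum n f).neg)
  have hu0 (g) : 0 ≤ u g :=
    sub_nonneg.2 (Real.exp_le_one_iff.2 (neg_nonpos.2 (bumpSum_nonneg n f g)))
  have hu1 (g) : u g ≤ 1 := sub_le_self _ (Real.exp_pos _).le
  have hu_int : Integrable u (phaseMeasure f) :=
    .of_bound hu.aestronglyMeasurable 1
      (.of_forall fun g => by rw [Real.norm_of_nonneg (hu0 g)]; exact hu1 g)
  set m : ℝ := ∫ g, u g ∂phaseMeasure f with hm_def
  have hm0 : 0 ≤ m := integral_nonneg hu0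
  have hm1 : m ≤ 1 / 8 := by
    refine (integral_mono hu_int (integrable_bumpSum hf hn) fun g => ?_).trans
      (integral_bumpSum_le hf hn)
    have := Real.add_one_le_exp (-bumpSum n f g)
    simp only [hu_def]
    linarith
  obtain ⟨τ, V₂, δ, h1, h2, h3, h4, h5, h6, h7, h8, h9, h10, h11⟩ :=
    (isErgodicEnvironment_phase f).exists_shear_of_long_excursions
      (v := fun g => 2 * (u g - m)) ((hu.sub_const m).const_mul 2)
      (fun g => abs_le.2 ⟨by linarith [hu0 g], by linarith [hu1 g]⟩)
      (fun g => by linarith [hu0 g])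
      (by rw [integral_const_mul, integral_sub hu_int (integrable_const m)]; simp [← hm_def])
      (hsum.mono fun g hg => isC11_const_mul_one_sub_exp_neg_bumpSum_sub hf hfn hg 2 m)
      (fun k => {g | ‖g.1 k‖ ≤ w k / 2}) (fun k => w k / (2 * f k))
      (fun k => by
        filter_upwards [hsum] with g hg hgk r hr
        have h3 := three_le_bumpSum hf hfn hg (hw k) hgk hr
        have h4 : Real.exp (-bumpSum n f (phasePath f r + g)) ≤ 1 / 4 := by
          rw [Real.exp_neg, ← one_div]
          exact one_div_le_one_div_of_le (by norm_num)
            (by linarith [Real.add_one_le_exp (bumpSum n f (phasePath f r + g))])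
        simp only [hu_def]
        linarith)
      (fun k => by
        have hball : phaseMeasure f {g | ‖g.1 k‖ ≤ w k / 2} = ENNReal.ofReal (w k) := by
          have h := (measurePreserving_phase f k (hf k).ne').measure_preimage
            (Metric.isClosed_closedBall (x := 0) (ε := w k / 2)).measurableSet.nullMeasurableSet
          rw [AddCircle.volume_closedBall, mul_div_cancel₀ _ two_ne_zero,
            min_eq_right ((hw1 k).trans (by norm_num))] at h
          rw [← h]
          congr 1
          ext g
          simp
        rw [hball, ← ENNReal.ofReal_mul (by have := hf k; have := hw0 k; positivity),
          ← ENNReal.ofReal_natCast]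
        refine ENNReal.ofReal_le_ofReal ?_
        have := hf k
        rw [div_mul_eq_mul_div, le_div_iff₀ (by positivity), ← sq]
        exact hfw k)
  exact ⟨PhaseGroup f, inferInstance, phaseMeasure f, inferInstance, τ, V₂, δ, h1, h2, h3, h4, h5,
    h6, h7, h8, h9, h10, .inr h11⟩
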